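/- Let $r>1$ and let $\mathcal C_1,\dots,\mathcal C_n$ be circles of radius $r$ in the Euclidean plane whose centers are distinct points of a fixed unit circle, listed in counter-clockwise order (for instance the vertices of a regular $n$-gon); call such a family a rosette of $n$ circles. Its regions are the connected components of the complement of $\mathcal C_1\cup\dots\cup\mathcal C_n$. A binary word $\sigma_1\cdots\sigma_n$ encodes a region if, for every $i$, the region lies inside $\mathcal C_i$ when $\sigma_i=1$ and outside $\mathcal C_i$ when $\sigma_i=0$. Let $\mathcal P_n$ be the set of words encoding the regions of a rosette of $n$ circles. (a) Every region is encoded by exactly one word, and every word of $\mathcal P_n$ encodes exactly one region. (b) For $n\ge 1$, whatever the rosettes of $n$ and of $n+1$ circles used to form $\mathcal P_n$ and $\mathcal P_{n+1}$ (in particular when the second is obtained from the first by inserting a circle centered on the open arc going counter-clockwise from the $n$-th to the first center), $$\mathcal P_{n+1}=\{\pi\sigma_1 : \pi=\sigma_1\cdots\sigma_n\in\mathcal P_n\}\ \cup\ \{0^k1^{n+1-k} : 1\le k\le n\}\ \cup\ \{1^k0^{n+1-k} : 1\le k\le n\},$$ and the words of the last two families are new, i.e. none of them belongs to the first set. (c)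 $\mathcal P_1=\{0,1\}$, $\mathcal P_2=\{00,01,10,11\}$, and for every $n\ge 1$ $$\mathcal P_n=\{0^n,1^n\}\cup\mathcal P_n^{00}\cup\mathcal P_n^{11}\cup\mathcal P_n^{01}\cup\mathcal P_n^{10},$$ where $\mathcal P_n^{00}=\{0^k1^{n-k} : 1\le k\le n-1\}$, $\mathcal P_n^{11}=\{1^k0^{n-k} : 1\le k\le n-1\}$, $\mathcal P_n^{01}=\{0^k1^{n-p-k}0^p : 1\le p\le n-2,\ 1\le k\le n-p-1\}$, $\mathcal P_n^{10}=\{1^k0^{n-p-k}1^p : 1\le p\le n-2,\ 1\le k\le n-p-1\}$. In particular $\mathcal P_n$ depends only on $n$. (d) For every $n\ge 1$, $\mathcal P_n$ is exactly the set of bitonic binary words of length $n$, that is, those with at most two changes between consecutive letters, and $\#\mathcal P_n=n^2-n+2$. -/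

import Mathlib

/-- The Euclidean plane. -/
abbrev Plane : Type := EuclideanSpace ℝ (Fin 2)

/-- A family of `n` congruent, pairwise non-concentric circles of common radius `r > 1`, centred on
the unit circle around `O`. The centre of the `i`-th circle sits at angle `angle i`; the two
conditions on the angles say that the centres are distinct and listed in counter-clockwise order.
(The regular case is `angle i = 2 * π * i / n`.) -/
structure Rosette (n : ℕ) where
  /-- centre of the reference circle -/
  O : Plane
  /-- common radius of the circles -/
  r : ℝ
  one_lt_r : 1 < r
  /-- angular position of the centres on the reference circle -/
  angle : Fin n → ℝ
  angle_strictMono : StrictMono angle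
  angle_lt : ∀ i j, angle j < angle i + 2 * Real.pi

namespace Rosette

variable {n : ℕ} (R : Rosette n)

/-- The centre of the `i`-th circle. -/
noncomputable def center (i : Fin n) : Plane :=
  R.O + !₂[Real.cos (R.angle i), Real.sin (R.angle i)]

/-- The points of the plane that lie on none of the circles. -/
def complement : Set Plane := (⋃ i, Metric.sphere (R.center i) R.r)ᶜ

/-- The regions: the connected components of the complement of the union of the circles. -/
def regions : Set (Set Plane) :=
  {U | ∃ x ∈ R.complement, U = connectedComponentIn R.complement x}

/-- The word `w = σ₁ ⋯ σₙ` encodes `U`: letter `1` (`true`) means that `U` lies inside the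
corresponding circle, letter `0` (`false`) that it lies outside. -/
def Encodes (w : List Bool) (U : Set Plane) : Prop :=
  ∃ σ : Fin n → Bool, w = List.ofFn σ ∧ ∀ i,
    (σ i = true → U ⊆ Metric.ball (R.center i) R.r) ∧
    (σ i = false → U ⊆ (Metric.closedBall (R.center i) R.r)ᶜ)

/-- The set of words encoding the regions. -/
def words : Set (List Bool) := {w | ∃ U ∈ R.regions, R.Encodes w U}

end Rosette

namespace BinWord

/-- `zeros k` is the word `0^k`. -/
def zeros (k : ℕ) : List Bool := List.replicate k false

/-- `ones k` is the word `1^k`. -/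
def ones (k : ℕ) : List Bool := List.replicate k true

/-- The words `0^k 1^(n-k)`, `1 ≤ k ≤ n - 1`. -/
def P00 (n : ℕ) : Set (List Bool) :=
  {w | ∃ k, 1 ≤ k ∧ k + 1 ≤ n ∧ w = zeros k ++ ones (n - k)}

/-- The words `1^k 0^(n-k)`, `1 ≤ k ≤ n - 1`. -/
def P11 (n : ℕ) : Set (List Bool) :=
  {w | ∃ k, 1 ≤ k ∧ k + 1 ≤ n ∧ w = ones k ++ zeros (n - k)}

/-- The words `0^k 1^(n-p-k) 0^p`, `1 ≤ p ≤ n - 2`, `1 ≤ k ≤ n - p - 1`. -/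
def P01 (n : ℕ) : Set (List Bool) :=
  {w | ∃ p k, 1 ≤ p ∧ p + 2 ≤ n ∧ 1 ≤ k ∧ k + p + 1 ≤ n ∧
    w = zeros k ++ ones (n - p - k) ++ zeros p}

/-- The words `1^k 0^(n-p-k) 1^p`, `1 ≤ p ≤ n - 2`, `1 ≤ k ≤ n - p - 1`. -/
def P10 (n : ℕ) : Set (List Bool) :=
  {w | ∃ p k, 1 ≤ p ∧ p + 2 ≤ n ∧ 1 ≤ k ∧ k + p + 1 ≤ n ∧
    w = ones k ++ zeros (n - p - k) ++ ones p}

/-- The words `π σ₁` with `π = σ₁ σ₂ ⋯ ∈ S`. -/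
def appendFirst (S : Set (List Bool)) : Set (List Bool) :=
  {w | ∃ (σ : Bool) (τ : List Bool), σ :: τ ∈ S ∧ w = (σ :: τ) ++ [σ]}

/-- A binary word is bitonic if it has at most two changes between consecutive letters. -/
def IsBitonic (w : List Bool) : Prop :=
  (w.zip w.tail).countP (fun p => p.1 != p.2) ≤ 2

end BinWord

/-!
Put the centre `O` of the reference circle at the origin and let `aᵢ` be the unit vector pointing to
the `i`-th centre. A point `y` lies inside the `i`-th circle exactly when
`(‖y‖² + 1 - r²) / 2 < ⟪y, aᵢ⟫`. So the map `y ↦ (y, (‖y‖² + 1 - r²) / 2)` turns the circles into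
the linear planes `⟪v, aᵢ⟫ = c` of the space of pairs `(v, c)`. As `r > 1`, every ray of that space
off the axis `v = 0` meets the image of this map in exactly one point, which `coneProj` computes.

*Regions are cells.* For a labelling `σ`, let the cell of `σ` be the set of points that lie inside
the `i`-th circle when `σ i = 1` and outside it when `σ i = 0`. If `σ` is not constant, the cell is
the continuous image under `coneProj` of the convex cone `{(v, c) | c < ⟪v, aᵢ⟫ iff σ i = 1}`, which
misses the axis; hence it is connected. The cell inside all the circles is convex. The cell outside
all the circles is connected because each of its points can be moved radially to one large circle
around `O`. So the regions are the nonempty cells (`Rosette.mem_regions_iff`), and they correspond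
bijectively to their words.

*Words are bitonic.* The cell of a nonconstant `σ` is nonempty exactly when some line strictly
separates the `aᵢ` with `σ i = 1` from the others. A word with three changes of letter has four
indices at which the letters alternate, and a line cannot separate the two diagonals of an inscribed
quadrilateral (`not_separate_diagonals`). Conversely, in a bitonic word `x^k y^m x^p` the block `y^m`
is cut off by a chord whose endpoints fall between consecutive centres
(`Rosette.exists_separating_chord`). Hence `Rosette.words_eq_bitonicWords`.

*Enumeration.* The remaining assertions concern the words `x^k y^m x^p` with `k ≥ 1` only. Those of
length `n + 1` whose first and last letters agree arise from those of length `n` by appending the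
first letter, and the others consist of two blocks. This recursion gives the count.
-/

open scoped RealInnerProductSpace

/-! ### Lifting the plane to a cone arrangement -/

/-- The unit vector of the plane at angle `θ`. -/
noncomputable def unitDir (θ : ℝ) : Plane := !₂[Real.cos θ, Real.sin θ]

lemma norm_unitDir (θ : ℝ) : ‖unitDir θ‖ = 1 := by
  simp [unitDir, EuclideanSpace.norm_eq]

lemma inner_unitDir (v : Plane) (θ : ℝ) :
    ⟪v, unitDir θ⟫ = v 0 * Real.cos θ + v 1 * Real.sin θ := by
  simp [unitDir, PiLp.inner_apply, Fin.sum_univ_two]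
  ring

lemma dist_add_unitDir_sq (O x : Plane) (θ : ℝ) :
    dist x (O + unitDir θ) ^ 2 = ‖x - O‖ ^ 2 - 2 * ⟪x - O, unitDir θ⟫ + 1 := by
  rw [dist_eq_norm, ← sub_sub, norm_sub_sq_real, norm_unitDir]
  norm_num

/-- The map sending `(v, c)` to the point of the open ray spanned by `v` at which a circle of
radius `r` centred at a unit vector `a` with `⟪v, a⟫ = c` meets that ray. It depends only on the
ray spanned by `(v, c)`, and its value at `v = 0` is irrelevant. -/
noncomputable def coneProj (r : ℝ) (p : Plane × ℝ) : Plane :=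
  ((p.2 + √((r ^ 2 - 1) * ‖p.1‖ ^ 2 + p.2 ^ 2)) / ‖p.1‖ ^ 2) • p.1

lemma continuousOn_coneProj (r : ℝ) : ContinuousOn (coneProj r) {p | p.1 ≠ 0} := by
  have hn : ∀ p ∈ {p : Plane × ℝ | p.1 ≠ 0}, ‖p.1‖ ^ 2 ≠ 0 :=
    fun p hp => pow_ne_zero 2 (norm_ne_zero_iff.mpr hp)
  have h1 : ContinuousOn (fun p : Plane × ℝ => p.2 + √((r ^ 2 - 1) * ‖p.1‖ ^ 2 + p.2 ^ 2))
      {p | p.1 ≠ 0} := by fun_prop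
  have h2 : ContinuousOn (fun p : Plane × ℝ => ‖p.1‖ ^ 2) {p | p.1 ≠ 0} := by fun_prop
  exact (h1.div h2 hn).smul continuous_fst.continuousOn

/-- The scaling factor `t` in `coneProj r (v, c) = t • v` is the positive root of
`‖v‖² t² - 2 c t - (r² - 1)`. -/
lemma coneProj_eq_smul {r : ℝ} (hr : 1 < r) {v : Plane} (hv : v ≠ 0) (c : ℝ) :
    ∃ t : ℝ, 0 < t ∧ coneProj r (v, c) = t • v ∧ t ^ 2 * ‖v‖ ^ 2 + 1 - r ^ 2 = 2 * t * c := by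
  have hN : 0 < ‖v‖ ^ 2 := pow_pos (norm_pos_iff.mpr hv) 2
  have hpos : 0 < (r ^ 2 - 1) * ‖v‖ ^ 2 := mul_pos (by nlinarith) hN
  set S := √((r ^ 2 - 1) * ‖v‖ ^ 2 + c ^ 2) with hS
  have hS2 : S ^ 2 = (r ^ 2 - 1) * ‖v‖ ^ 2 + c ^ 2 := Real.sq_sqrt (by positivity)
  have hcS : |c| < S := Real.lt_sqrt_of_sq_lt (by rw [sq_abs]; linarith)
  refine ⟨(c + S) / ‖v‖ ^ 2, div_pos (by linarith [neg_abs_le c]) hN, rfl, ?_⟩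
  field_simp
  linear_combination hS2

/-- Every nonzero `y` is the projection of `(y, c)` for the value of `c` that governs on which side
of the circles `y` lies. -/
lemma coneProj_self {r : ℝ} (hr : 1 < r) {y : Plane} (hy : y ≠ 0) :
    coneProj r (y, (‖y‖ ^ 2 + 1 - r ^ 2) / 2) = y := by
  have hN : 0 < ‖y‖ ^ 2 := pow_pos (norm_pos_iff.mpr hy) 2
  have : √((r ^ 2 - 1) * ‖y‖ ^ 2 + ((‖y‖ ^ 2 + 1 - r ^ 2) / 2) ^ 2) =
      (‖y‖ ^ 2 + r ^ 2 - 1) / 2 := by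
    rw [show (r ^ 2 - 1) * ‖y‖ ^ 2 + ((‖y‖ ^ 2 + 1 - r ^ 2) / 2) ^ 2 =
      ((‖y‖ ^ 2 + r ^ 2 - 1) / 2) ^ 2 by ring]
    exact Real.sqrt_sq (by nlinarith)
  rw [coneProj, this, show (‖y‖ ^ 2 + 1 - r ^ 2) / 2 + (‖y‖ ^ 2 + r ^ 2 - 1) / 2 = ‖y‖ ^ 2 by ring,
    div_self hN.ne', one_smul]

namespace Rosette

variable {n : ℕ} (R : Rosette n)

lemma center_eq (i : Fin n) : R.center i = R.O + unitDir (R.angle i) := rfl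

lemma mem_ball_center_iff (i : Fin n) (x : Plane) :
    x ∈ Metric.ball (R.center i) R.r ↔
      (‖x - R.O‖ ^ 2 + 1 - R.r ^ 2) / 2 < ⟪x - R.O, unitDir (R.angle i)⟫ := by
  have h := dist_add_unitDir_sq R.O x (R.angle i)
  have hr := R.one_lt_r
  rw [Metric.mem_ball, center_eq, ← sq_lt_sq₀ dist_nonneg (by linarith), h]
  constructor <;> intro h <;> linarith

lemma mem_compl_closedBall_center_iff (i : Fin n) (x : Plane) :
    x ∈ (Metric.closedBall (R.center i) R.r)ᶜ ↔
      ⟪x - R.O, unitDir (R.angle i)⟫ < (‖x - R.O‖ ^ 2 + 1 - R.r ^ 2) / 2 := by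
  have h := dist_add_unitDir_sq R.O x (R.angle i)
  have hr := R.one_lt_r
  rw [Set.mem_compl_iff, Metric.mem_closedBall, not_le, center_eq,
    ← sq_lt_sq₀ (by linarith) dist_nonneg, h]
  constructor <;> intro h <;> linarith

/-- The points lying inside the `i`-th circle when `σ i = true` and outside it when
`σ i = false`. -/
def cell (σ : Fin n → Bool) : Set Plane :=
  {x | ∀ i, (σ i = true → x ∈ Metric.ball (R.center i) R.r) ∧
    (σ i = false → x ∈ (Metric.closedBall (R.center i) R.r)ᶜ)}

/-- The open convex cone of `Plane × ℝ` of all `(v, c)` such that the line `⟪v, ·⟫ = c` separates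
the directions of the centres labelled `true` from those labelled `false`. -/
def cone (σ : Fin n → Bool) : Set (Plane × ℝ) :=
  {p | ∀ i, (σ i = true → p.2 < ⟪p.1, unitDir (R.angle i)⟫) ∧
    (σ i = false → ⟪p.1, unitDir (R.angle i)⟫ < p.2)}

lemma mem_cell_iff (σ : Fin n → Bool) (x : Plane) :
    x ∈ R.cell σ ↔ (x - R.O, (‖x - R.O‖ ^ 2 + 1 - R.r ^ 2) / 2) ∈ R.cone σ := by
  simp only [cell, cone, Set.mem_ofPred_eq, mem_ball_center_iff, mem_compl_closedBall_center_iff]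

lemma convex_cone (σ : Fin n → Bool) : Convex ℝ (R.cone σ) := by
  intro p hp q hq a b ha hb hab i
  have key : ∀ P Q : ℝ, 0 < P → 0 < Q → 0 < a * P + b * Q := by
    intro P Q hP hQ
    rcases ha.eq_or_lt with h | h
    · obtain rfl : b = 1 := by linarith
      subst h; linarith
    · have := mul_pos h hP
      have := mul_nonneg hb hQ.le
      linarith
  simp only [Prod.fst_add, Prod.snd_add, Prod.smul_fst, Prod.smul_snd, inner_add_left,
    real_inner_smul_left, smul_eq_mul]
  constructor <;> intro hi
  · have := key _ _ (sub_pos.2 ((hp i).1 hi)) (sub_pos.2 ((hq i).1 hi))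
    linarith
  · have := key _ _ (sub_pos.2 ((hp i).2 hi)) (sub_pos.2 ((hq i).2 hi))
    linarith

lemma coneProj_mem_cell {σ : Fin n → Bool} {p : Plane × ℝ} (hp : p ∈ R.cone σ) (hv : p.1 ≠ 0) :
    R.O + coneProj R.r p ∈ R.cell σ := by
  obtain ⟨v, c⟩ := p
  obtain ⟨t, ht, he, hq⟩ := coneProj_eq_smul R.one_lt_r hv c
  rw [mem_cell_iff, add_sub_cancel_left, he]
  have hn : (‖t • v‖ ^ 2 + 1 - R.r ^ 2) / 2 = t * c := by
    rw [norm_smul, mul_pow, Real.norm_eq_abs, sq_abs, hq]; ring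
  intro i
  simp only [hn, real_inner_smul_left]
  exact ⟨fun hi => mul_lt_mul_of_pos_left ((hp i).1 hi) ht,
    fun hi => mul_lt_mul_of_pos_left ((hp i).2 hi) ht⟩

/-- A cone cut out by both kinds of inequality misses the axis `v = 0`. -/
lemma fst_ne_zero_of_mem_cone {σ : Fin n → Bool} {i j : Fin n} (hi : σ i = true) (hj : σ j = false)
    {p : Plane × ℝ} (hp : p ∈ R.cone σ) : p.1 ≠ 0 := by
  intro h0
  have h1 := (hp i).1 hi
  have h2 := (hp j).2 hj
  rw [h0, inner_zero_left] at h1 h2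
  exact lt_asymm h1 h2

/-! ### Connectedness of the cells -/

lemma isPreconnected_cell_of_ne {σ : Fin n → Bool} {i j : Fin n} (hi : σ i = true)
    (hj : σ j = false) : IsPreconnected (R.cell σ) := by
  have hne : R.cone σ ⊆ {p | p.1 ≠ 0} := fun p hp => R.fst_ne_zero_of_mem_cone hi hj hp
  have himg : R.cell σ = (fun p => R.O + coneProj R.r p) '' R.cone σ := by
    ext x
    constructor
    · intro hx
      have hx' := (R.mem_cell_iff σ x).1 hx
      refine ⟨_, hx', ?_⟩
      simp only [coneProj_self R.one_lt_r (hne hx'), add_sub_cancel]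
    · rintro ⟨p, hp, rfl⟩
      exact R.coneProj_mem_cell hp (hne hp)
  rw [himg]
  exact (R.convex_cone σ).isPreconnected.image _
    (continuousOn_const.add ((continuousOn_coneProj R.r).mono hne))

lemma isPreconnected_cell_true : IsPreconnected (R.cell fun _ => true) := by
  have : R.cell (fun _ => true) = ⋂ i, Metric.ball (R.center i) R.r := by
    ext x; simp [cell]
  rw [this]
  exact (convex_iInter fun i => convex_ball _ _).isPreconnected

/-- Moving a point that is outside all the circles away from `O` keeps it outside: this is where
`1 < r`, that is, `O` inside all the circles, is used. -/
lemma smul_mem_cell_false {x : Plane} (hx : x ∈ R.cell fun _ => false) {t : ℝ}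
    (ht : 1 ≤ t) : R.O + t • (x - R.O) ∈ R.cell fun _ => false := by
  have hr := R.one_lt_r
  rw [mem_cell_iff] at hx ⊢
  rw [add_sub_cancel_left]
  intro i
  refine ⟨fun h => by simp at h, fun _ => ?_⟩
  have h := (hx i).2 rfl
  simp only at h
  simp only [norm_smul, mul_pow, Real.norm_eq_abs, sq_abs, real_inner_smul_left]
  have h0 := mul_lt_mul_of_pos_left h (by linarith : 0 < t)
  have h1 : 0 ≤ (t - 1) * (t * ‖x - R.O‖ ^ 2 + (R.r ^ 2 - 1)) :=
    mul_nonneg (by linarith) (add_nonneg (by positivity) (by nlinarith))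
  nlinarith

lemma mem_cell_false_of_le {x : Plane} (hx : R.r + 2 ≤ ‖x - R.O‖) :
    x ∈ R.cell fun _ => false := by
  intro i
  refine ⟨fun h => by simp at h, fun _ => ?_⟩
  have h2 : ‖x - R.O‖ ≤ dist x (R.center i) + 1 := by
    rw [center_eq, dist_eq_norm]
    calc ‖x - R.O‖ = ‖(x - (R.O + unitDir (R.angle i))) + unitDir (R.angle i)‖ := by congr 1; abel
      _ ≤ _ := by rw [← norm_unitDir (R.angle i)]; exact norm_add_le _ _
  simp only [Set.mem_compl_iff, Metric.mem_closedBall, not_le]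
  linarith

lemma isPreconnected_cell_false (hn : 0 < n) : IsPreconnected (R.cell fun _ => false) := by
  have hr := R.one_lt_r
  have hrank : 1 < Module.rank ℝ Plane := by
    rw [← Module.finrank_eq_rank]
    simp
  refine isPreconnected_of_forall_pair fun x hx y hy => ?_
  have hO : ∀ z ∈ R.cell (fun _ => false), 0 < ‖z - R.O‖ := by
    intro z hz
    rw [norm_pos_iff]
    intro h0
    have := ((R.mem_cell_iff _ z).1 hz ⟨0, hn⟩).2 rfl
    simp only [h0, inner_zero_left, norm_zero] at this
    nlinarith
  -- a sphere around `O` that encloses all the circles as well as both points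
  set M : ℝ := R.r + 2 + ‖x - R.O‖ + ‖y - R.O‖ with hM
  have hM0 : 0 ≤ M := by positivity
  have hsph : Metric.sphere R.O M ⊆ R.cell fun _ => false := by
    intro z hz
    refine R.mem_cell_false_of_le ?_
    rw [mem_sphere_iff_norm] at hz
    rw [hz]; linarith [norm_nonneg (x - R.O), norm_nonneg (y - R.O)]
  have hray : ∀ z ∈ R.cell (fun _ => false), ‖z - R.O‖ ≤ M → ∃ S ⊆ R.cell (fun _ => false),
      IsPreconnected S ∧ z ∈ S ∧ (S ∩ Metric.sphere R.O M).Nonempty := by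
    intro z hz hzM
    have hz0 := hO z hz
    refine ⟨(fun t : ℝ => R.O + t • (z - R.O)) '' Set.Ici 1, ?_, ?_, ?_, ?_⟩
    · rintro _ ⟨t, ht, rfl⟩
      exact R.smul_mem_cell_false hz ht
    · exact isPreconnected_Ici.image _ (by fun_prop)
    · exact ⟨1, Set.self_mem_Ici, by simp⟩
    · refine ⟨_, ⟨M / ‖z - R.O‖, ?_, rfl⟩, ?_⟩
      · rw [Set.mem_Ici, le_div_iff₀ hz0]; linarith
      · rw [mem_sphere_iff_norm, add_sub_cancel_left, norm_smul, Real.norm_eq_abs,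
          abs_of_nonneg (by positivity), div_mul_cancel₀ _ hz0.ne']
  obtain ⟨S, hS, hSc, hxS, p, hpS, hpM⟩ := hray x hx (by linarith [norm_nonneg (y - R.O)])
  obtain ⟨T, hT, hTc, hyT, q, hqT, hqM⟩ := hray y hy (by linarith [norm_nonneg (x - R.O)])
  refine ⟨S ∪ Metric.sphere R.O M ∪ T, Set.union_subset (Set.union_subset hS hsph) hT,
    Or.inl (Or.inl hxS), Or.inr hyT, ?_⟩
  exact (hSc.union p hpS hpM (isPreconnected_sphere hrank _ _)).union q (Or.inr hqM) hqT hTc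

lemma isPreconnected_cell (σ : Fin n → Bool) : IsPreconnected (R.cell σ) := by
  by_cases h1 : ∃ i, σ i = true
  · obtain ⟨i, hi⟩ := h1
    by_cases h2 : ∃ j, σ j = false
    · obtain ⟨j, hj⟩ := h2
      exact R.isPreconnected_cell_of_ne hi hj
    · obtain rfl : σ = fun _ => true := by ext j; simpa using fun h => h2 ⟨j, h⟩
      exact R.isPreconnected_cell_true
  · obtain rfl : σ = fun _ => false := by ext j; simpa using fun h => h1 ⟨j, h⟩
    rcases n.eq_zero_or_pos with rfl | hn
    · rw [Subsingleton.elim (fun _ : Fin 0 => false) fun _ => true]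
      exact R.isPreconnected_cell_true
    · exact R.isPreconnected_cell_false hn

/-! ### Regions and their words -/

lemma cell_subset_complement (σ : Fin n → Bool) : R.cell σ ⊆ R.complement := by
  intro x hx hmem
  obtain ⟨i, hi⟩ := Set.mem_iUnion.1 hmem
  rw [Metric.mem_sphere] at hi
  cases h : σ i with
  | true => exact absurd ((hx i).1 h) (by simp [hi])
  | false => exact absurd ((hx i).2 h) (by simp [hi])

lemma encodes_ofFn_iff (σ : Fin n → Bool) (U : Set Plane) :
    R.Encodes (List.ofFn σ) U ↔ U ⊆ R.cell σ := by
  constructor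
  · rintro ⟨τ, hτ, h⟩ x hx i
    obtain rfl := List.ofFn_injective hτ
    exact ⟨fun hi => (h i).1 hi hx, fun hi => (h i).2 hi hx⟩
  · intro h
    exact ⟨σ, rfl, fun i => ⟨fun hi x hx => (h hx i).1 hi, fun hi x hx => (h hx i).2 hi⟩⟩

lemma eq_of_mem_cell {σ τ : Fin n → Bool} {x : Plane} (hσ : x ∈ R.cell σ) (hτ : x ∈ R.cell τ) :
    σ = τ := by
  ext i
  have h1 := hσ i
  have h2 := hτ i
  simp only [Metric.mem_ball, Set.mem_compl_iff, Metric.mem_closedBall, not_le] at h1 h2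
  cases hs : σ i <;> cases ht : τ i <;> simp [hs, ht] at h1 h2 ⊢ <;> linarith

lemma subset_ball_or_subset_compl {U : Set Plane} (hU : IsPreconnected U)
    (hUc : U ⊆ R.complement) (i : Fin n) :
    U ⊆ Metric.ball (R.center i) R.r ∨ U ⊆ (Metric.closedBall (R.center i) R.r)ᶜ := by
  refine isPreconnected_iff_subset_of_disjoint.1 hU _ _ Metric.isOpen_ball
    Metric.isClosed_closedBall.isOpen_compl ?_ ?_
  · intro x hx
    have : dist x (R.center i) ≠ R.r := fun h => hUc hx (Set.mem_iUnion.2 ⟨i, h⟩)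
    rcases this.lt_or_gt with h | h
    · exact Or.inl h
    · exact Or.inr (by simpa using h)
  · rw [Set.eq_empty_iff_forall_notMem]
    rintro x ⟨-, h1, h2⟩
    exact h2 (Metric.ball_subset_closedBall h1)

lemma exists_subset_cell {U : Set Plane} (hU : IsPreconnected U) (hUc : U ⊆ R.complement) :
    ∃ σ, U ⊆ R.cell σ := by
  classical
  refine ⟨fun i => decide (U ⊆ Metric.ball (R.center i) R.r), fun x hx i => ⟨fun hi => ?_,
    fun hi => ?_⟩⟩
  · exact of_decide_eq_true hi hx
  · exact (R.subset_ball_or_subset_compl hU hUc i).resolve_left (of_decide_eq_false hi) hx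

lemma connectedComponentIn_eq_cell {σ : Fin n → Bool} {x : Plane} (hx : x ∈ R.cell σ) :
    connectedComponentIn R.complement x = R.cell σ := by
  refine Set.Subset.antisymm ?_ ((R.isPreconnected_cell σ).subset_connectedComponentIn hx
    (R.cell_subset_complement σ))
  obtain ⟨τ, hτ⟩ := R.exists_subset_cell isPreconnected_connectedComponentIn
    (connectedComponentIn_subset R.complement x)
  rwa [R.eq_of_mem_cell hx (hτ (mem_connectedComponentIn (R.cell_subset_complement σ hx)))]

/-- The regions are exactly the nonempty cells. -/
lemma mem_regions_iff (U : Set Plane) :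
    U ∈ R.regions ↔ ∃ σ, U = R.cell σ ∧ (R.cell σ).Nonempty := by
  constructor
  · rintro ⟨x, hx, rfl⟩
    obtain ⟨σ, hσ⟩ := R.exists_subset_cell isPreconnected_connectedComponentIn
      (connectedComponentIn_subset R.complement x)
    have hxσ := hσ (mem_connectedComponentIn hx)
    exact ⟨σ, R.connectedComponentIn_eq_cell hxσ, x, hxσ⟩
  · rintro ⟨σ, rfl, x, hx⟩
    exact ⟨x, R.cell_subset_complement σ hx, (R.connectedComponentIn_eq_cell hx).symm⟩

lemma encodes_cell_iff {σ : Fin n → Bool} (hσ : (R.cell σ).Nonempty) (w : List Bool) :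
    R.Encodes w (R.cell σ) ↔ w = List.ofFn σ := by
  constructor
  · intro h
    obtain ⟨τ, rfl, -⟩ := id h
    obtain ⟨x, hx⟩ := hσ
    rw [R.eq_of_mem_cell hx ((R.encodes_ofFn_iff τ _).1 h hx)]
  · rintro rfl
    exact (R.encodes_ofFn_iff σ _).2 subset_rfl

lemma existsUnique_encodes {U : Set Plane} (hU : U ∈ R.regions) : ∃! w, R.Encodes w U := by
  obtain ⟨σ, rfl, hσ⟩ := (R.mem_regions_iff U).1 hU
  simp only [R.encodes_cell_iff hσ]
  exact existsUnique_eq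

lemma existsUnique_region {w : List Bool} (hw : w ∈ R.words) :
    ∃! U, U ∈ R.regions ∧ R.Encodes w U := by
  obtain ⟨U, hU, hwU⟩ := hw
  refine ⟨U, ⟨hU, hwU⟩, ?_⟩
  rintro V ⟨hV, hwV⟩
  obtain ⟨σ, rfl, hσ⟩ := (R.mem_regions_iff U).1 hU
  obtain ⟨τ, rfl, hτ⟩ := (R.mem_regions_iff V).1 hV
  rw [R.encodes_cell_iff hσ] at hwU
  rw [R.encodes_cell_iff hτ] at hwV
  rw [List.ofFn_injective (hwV.symm.trans hwU)]

lemma mem_words_iff (w : List Bool) :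
    w ∈ R.words ↔ ∃ σ, w = List.ofFn σ ∧ (R.cell σ).Nonempty := by
  constructor
  · rintro ⟨U, hU, hwU⟩
    obtain ⟨σ, rfl, hσ⟩ := (R.mem_regions_iff U).1 hU
    exact ⟨σ, (R.encodes_cell_iff hσ w).1 hwU, hσ⟩
  · rintro ⟨σ, rfl, hσ⟩
    exact ⟨_, (R.mem_regions_iff _).2 ⟨σ, rfl, hσ⟩, (R.encodes_cell_iff hσ _).2 rfl⟩

end Rosette

/-! ### Bitonic words -/

namespace BinWord

/-- The number of changes between consecutive letters. -/
def changes (w : List Bool) : ℕ := (w.zip w.tail).countP (fun p => p.1 != p.2)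

lemma changes_cons_cons (a b : Bool) (l : List Bool) :
    changes (a :: b :: l) = changes (b :: l) + if a = b then 0 else 1 := by
  by_cases h : a = b <;> simp [changes, h]

lemma changes_replicate_append (a : Bool) (k : ℕ) (l : List Bool) :
    changes (List.replicate k a ++ l) ≤ changes l + 1 := by
  induction k with
  | zero => simp
  | succ k ih =>
    cases k with
    | zero =>
      cases l with
      | nil => simp [changes]
      | cons b l => simp [changes_cons_cons]; split <;> simp
    | succ k =>
      simp only [List.replicate_succ, List.cons_append, changes_cons_cons] at ih ⊢
      simpa using ih

lemma changes_replicate (a : Bool) (k : ℕ) : changes (List.replicate k a) = 0 := by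
  induction k with
  | zero => simp [changes]
  | succ k ih =>
    cases k with
    | zero => simp [changes]
    | succ k =>
      simp only [List.replicate_succ, changes_cons_cons] at ih ⊢
      simpa using ih

/-- The word `x^k y^m x^p`, where `y` is the letter other than `x`. -/
def threeBlocks (x : Bool) (k m p : ℕ) : List Bool :=
  List.replicate k x ++ (List.replicate m (!x) ++ List.replicate p x)

lemma length_threeBlocks (x : Bool) (k m p : ℕ) : (threeBlocks x k m p).length = k + (m + p) := by
  simp [threeBlocks]

lemma isBitonic_threeBlocks (x : Bool) (k m p : ℕ) : IsBitonic (threeBlocks x k m p) := by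
  have h1 := changes_replicate_append x k (List.replicate m (!x) ++ List.replicate p x)
  have h2 := changes_replicate_append (!x) m (List.replicate p x)
  rw [changes_replicate] at h2
  change changes _ ≤ 2
  unfold threeBlocks
  omega

lemma eq_replicate_of_changes_eq_zero (x : Bool) (l : List Bool) (h : changes (x :: l) = 0) :
    ∃ k, x :: l = List.replicate (k + 1) x := by
  induction l with
  | nil => exact ⟨0, rfl⟩
  | cons b l ih =>
    rw [changes_cons_cons] at h
    obtain rfl : x = b := by by_contra hb; simp [hb] at h
    obtain ⟨k, hk⟩ := ih (by omega)
    exact ⟨k + 1, by rw [hk]; rfl⟩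

lemma eq_twoBlocks_of_changes_le_one (x : Bool) (l : List Bool) (h : changes (x :: l) ≤ 1) :
    ∃ k m, x :: l = List.replicate (k + 1) x ++ List.replicate m (!x) := by
  induction l with
  | nil => exact ⟨0, 0, rfl⟩
  | cons b l ih =>
    rw [changes_cons_cons] at h
    by_cases hb : x = b
    · subst hb
      obtain ⟨k, m, hk⟩ := ih (by simpa using h)
      exact ⟨k + 1, m, by rw [hk]; rfl⟩
    · obtain rfl : b = !x := by cases b <;> cases x <;> simp_all
      obtain ⟨k, hk⟩ := eq_replicate_of_changes_eq_zero (!x) l (by simpa using h)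
      exact ⟨0, k + 1, by rw [hk]; rfl⟩

lemma eq_threeBlocks_of_isBitonic (x : Bool) (l : List Bool) (h : IsBitonic (x :: l)) :
    ∃ k m p, x :: l = threeBlocks x (k + 1) m p := by
  change changes _ ≤ 2 at h
  induction l with
  | nil => exact ⟨0, 0, 0, rfl⟩
  | cons b l ih =>
    rw [changes_cons_cons] at h
    by_cases hb : x = b
    · subst hb
      obtain ⟨k, m, p, hk⟩ := ih (by simpa using h)
      exact ⟨k + 1, m, p, by rw [hk]; rfl⟩
    · obtain rfl : b = !x := by cases b <;> cases x <;> simp_all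
      obtain ⟨k, m, hk⟩ := eq_twoBlocks_of_changes_le_one (!x) l (by simpa using h)
      exact ⟨0, k + 1, m, by rw [hk]; simp [threeBlocks]⟩

/-- The words of length `n` with at most two changes of letter. -/
def bitonicWords (n : ℕ) : Set (List Bool) := {w | w.length = n ∧ IsBitonic w}

lemma mem_bitonicWords_iff {n : ℕ} (hn : 1 ≤ n) (w : List Bool) :
    w ∈ bitonicWords n ↔ ∃ x k m p, k + 1 + (m + p) = n ∧ w = threeBlocks x (k + 1) m p := by
  constructor
  · rintro ⟨hl, hb⟩
    cases w with
    | nil => simp at hl; omega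
    | cons x l =>
      obtain ⟨k, m, p, h⟩ := eq_threeBlocks_of_isBitonic x l hb
      exact ⟨x, k, m, p, by rw [← hl, h, length_threeBlocks], h⟩
  · rintro ⟨x, k, m, p, h, rfl⟩
    exact ⟨by rw [length_threeBlocks, h], isBitonic_threeBlocks _ _ _ _⟩

/-- The word `x y x y ⋯` of length `k`, where `y` is the letter other than `x`. -/
def alternating : Bool → ℕ → List Bool
  | _, 0 => []
  | x, k + 1 => x :: alternating (!x) k

/-- A word with at least `k` changes has an alternating subword of length `k + 1`. -/
lemma alternating_sublist (k : ℕ) (x : Bool) (l : List Bool) (h : k ≤ changes (x :: l)) :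
    (alternating x (k + 1)).Sublist (x :: l) := by
  induction l generalizing x k with
  | nil =>
    obtain rfl : k = 0 := by simpa [changes] using h
    simp [alternating]
  | cons b l ih =>
    rw [changes_cons_cons] at h
    by_cases hb : x = b
    · subst hb
      exact (ih k x (by simpa using h)).cons _
    · obtain rfl : b = !x := by cases b <;> cases x <;> simp_all
      cases k with
      | zero => simp [alternating]
      | succ k => exact (ih k (!x) (by simpa using h)).cons_cons x

lemma exists_alternating_of_not_isBitonic {n : ℕ} (σ : Fin n → Bool)
    (h : ¬ IsBitonic (List.ofFn σ)) :
    ∃ i j k l, i < j ∧ j < k ∧ k < l ∧ σ j = !σ i ∧ σ k = σ i ∧ σ l = !σ i := by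
  change ¬ changes _ ≤ 2 at h
  obtain ⟨x, l, hw⟩ : ∃ x l, List.ofFn σ = x :: l := by
    cases hw : List.ofFn σ with
    | nil => simp [hw, changes] at h
    | cons x l => exact ⟨x, l, rfl⟩
  have hs : ([x, !x, x, !x] : List Bool).Sublist (List.ofFn σ) := by
    have := alternating_sublist 3 x l (by rw [← hw]; omega)
    simpa [alternating, hw] using this
  obtain ⟨f, hf⟩ := List.sublist_iff_exists_fin_orderEmbedding_get_eq.1 hs
  have hval : ∀ a, σ (Fin.cast (List.length_ofFn) (f a)) = [x, !x, x, !x].get a := by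
    intro a; rw [hf a, List.get_ofFn]
  have hlt : ∀ a b, a < b → Fin.cast (List.length_ofFn (f := σ)) (f a) <
      Fin.cast (List.length_ofFn) (f b) := fun a b hab => f.strictMono hab
  refine ⟨_, _, _, _, hlt ⟨0, by simp⟩ ⟨1, by simp⟩ (by simp), hlt _ ⟨2, by simp⟩ (by simp),
    hlt _ ⟨3, by simp⟩ (by simp), ?_, ?_, ?_⟩ <;> simp [hval]

/-! ### Explicit description, recursion and enumeration of the bitonic words -/

lemma threeBlocks_zero_right (x : Bool) (k m : ℕ) :
    threeBlocks x k m 0 = List.replicate k x ++ List.replicate m (!x) := by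
  simp [threeBlocks]

lemma threeBlocks_zero_mid (x : Bool) (k p : ℕ) :
    threeBlocks x k 0 p = List.replicate (k + p) x := by
  simp [threeBlocks]

lemma bitonicWords_eq {n : ℕ} (hn : 1 ≤ n) :
    bitonicWords n = {zeros n, ones n} ∪ P00 n ∪ P11 n ∪ P01 n ∪ P10 n := by
  ext w
  rw [mem_bitonicWords_iff hn]
  constructor
  · rintro ⟨x, k, m, p, h, rfl⟩
    rcases m.eq_zero_or_pos with rfl | hm
    · rw [threeBlocks_zero_mid, show k + 1 + p = n by omega]
      cases x <;> simp [zeros, ones]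
    rcases p.eq_zero_or_pos with rfl | hp
    · rw [threeBlocks_zero_right]
      obtain rfl : m = n - (k + 1) := by omega
      cases x
      · exact Or.inl (Or.inl (Or.inl (Or.inr ⟨k + 1, by omega, by omega, rfl⟩)))
      · exact Or.inl (Or.inl (Or.inr ⟨k + 1, by omega, by omega, rfl⟩))
    · obtain rfl : m = n - p - (k + 1) := by omega
      cases x
      · exact Or.inl (Or.inr ⟨p, k + 1, by omega, by omega, by omega, by omega,
          by simp [threeBlocks, zeros, ones]⟩)
      · exact Or.inr ⟨p, k + 1, by omega, by omega, by omega, by omega,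
          by simp [threeBlocks, zeros, ones]⟩
  · rintro ((((( rfl | rfl) | ⟨k, h1, h2, rfl⟩) | ⟨k, h1, h2, rfl⟩) |
      ⟨p, k, h1, h2, h3, h4, rfl⟩) | ⟨p, k, h1, h2, h3, h4, rfl⟩)
    · exact ⟨false, n - 1, 0, 0, by omega, by
        rw [threeBlocks_zero_mid, show n - 1 + 1 + 0 = n by omega]; rfl⟩
    · exact ⟨true, n - 1, 0, 0, by omega, by
        rw [threeBlocks_zero_mid, show n - 1 + 1 + 0 = n by omega]; rfl⟩
    · exact ⟨false, k - 1, n - k, 0, by omega, by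
        rw [threeBlocks_zero_right, show k - 1 + 1 = k by omega]; rfl⟩
    · exact ⟨true, k - 1, n - k, 0, by omega, by
        rw [threeBlocks_zero_right, show k - 1 + 1 = k by omega]; rfl⟩
    · exact ⟨false, k - 1, n - p - k, p, by omega, by
        rw [show k - 1 + 1 = k by omega]; simp [threeBlocks, zeros, ones]⟩
    · exact ⟨true, k - 1, n - p - k, p, by omega, by
        rw [show k - 1 + 1 = k by omega]; simp [threeBlocks, zeros, ones]⟩

/-- Appending its first letter to `x^k y^m x^p` yields `x^k y^m x^(p+1)`; the bitonic words that are
not of this form are those made of exactly two blocks. -/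
lemma bitonicWords_succ {n : ℕ} (hn : 1 ≤ n) :
    bitonicWords (n + 1) = appendFirst (bitonicWords n) ∪ (P00 (n + 1) ∪ P11 (n + 1)) := by
  have happ : ∀ x k m p, threeBlocks x k m (p + 1) = threeBlocks x k m p ++ [x] := by
    intro x k m p
    simp [threeBlocks, List.replicate_succ']
  ext w
  constructor
  · intro hw
    obtain ⟨x, k, m, p, h, rfl⟩ := (mem_bitonicWords_iff (by omega) w).1 hw
    have hmem : ∀ k m p, k + 1 + (m + p) = n →
        threeBlocks x (k + 1) m (p + 1) ∈ appendFirst (bitonicWords n) := by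
      intro k m p h
      exact ⟨x, _, (mem_bitonicWords_iff hn _).2 ⟨x, k, m, p, h, rfl⟩, happ _ _ _ _⟩
    cases p with
    | succ p => exact Or.inl (hmem k m p (by omega))
    | zero =>
      rcases m.eq_zero_or_pos with rfl | hm
      · left
        have := hmem (k - 1) 0 0 (by omega)
        rwa [threeBlocks_zero_mid, show k - 1 + 1 + (0 + 1) = k + 1 + 0 by omega,
          ← threeBlocks_zero_mid] at this
      · right
        rw [threeBlocks_zero_right]
        obtain rfl : m = n + 1 - (k + 1) := by omega
        cases x
        · exact Or.inl ⟨k + 1, by omega, by omega, rfl⟩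
        · exact Or.inr ⟨k + 1, by omega, by omega, rfl⟩
  · rintro (⟨x, τ, hπ, rfl⟩ | h)
    · obtain ⟨y, k, m, p, h, he⟩ := (mem_bitonicWords_iff hn _).1 hπ
      obtain rfl : x = y := by simp [threeBlocks, List.replicate_succ] at he; exact he.1
      rw [he, ← happ]
      exact (mem_bitonicWords_iff (by omega) _).2 ⟨x, k, m, p + 1, by omega, rfl⟩
    · rw [bitonicWords_eq (by omega)]
      rcases h with h | h
      · exact Or.inl (Or.inl (Or.inl (Or.inr h)))
      · exact Or.inl (Or.inl (Or.inr h))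

lemma head?_ne_getLast?_of_mem {n : ℕ} {w : List Bool} (hw : w ∈ P00 n ∪ P11 n) :
    w.head? ≠ w.getLast? := by
  rcases hw with ⟨k, h1, h2, rfl⟩ | ⟨k, h1, h2, rfl⟩ <;>
  · obtain ⟨a, rfl⟩ : ∃ a, k = a + 1 := ⟨k - 1, by omega⟩
    obtain ⟨b, hb⟩ : ∃ b, n - (a + 1) = b + 1 := ⟨n - (a + 1) - 1, by omega⟩
    rw [hb, List.getLast?_append]
    simp [zeros, ones, List.replicate_succ' (n := b), List.replicate_succ (n := a)]

/-- Words of the first family begin and end with the same letter, the others do not. -/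
lemma disjoint_appendFirst (S : Set (List Bool)) (n : ℕ) :
    Disjoint (appendFirst S) (P00 n ∪ P11 n) := by
  rw [Set.disjoint_left]
  rintro w ⟨x, τ, -, rfl⟩ hw
  apply head?_ne_getLast?_of_mem hw
  rw [List.getLast?_append]
  simp

lemma ncard_appendFirst {S : Set (List Bool)} (hS : [] ∉ S) :
    (appendFirst S).ncard = S.ncard := by
  have himg : appendFirst S = (fun w => w ++ w.take 1) '' S := by
    ext w
    constructor
    · rintro ⟨x, τ, h, rfl⟩
      exact ⟨_, h, by simp⟩
    · rintro ⟨u, hu, rfl⟩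
      cases u with
      | nil => exact absurd hu hS
      | cons x τ => exact ⟨x, τ, hu, by simp⟩
  rw [himg]
  refine Set.InjOn.ncard_image ?_
  intro u hu v hv h
  have hlen : ∀ z ∈ S, (z.take 1).length = 1 := by
    intro z hz
    cases z with
    | nil => exact absurd hz hS
    | cons x τ => simp
  exact List.append_inj_left' h (by rw [hlen u hu, hlen v hv])

lemma ncard_P00_union_P11 (n : ℕ) : (P00 (n + 1) ∪ P11 (n + 1)).ncard = 2 * n := by
  let f : Bool → ℕ → List Bool := fun x k =>
    List.replicate (k + 1) x ++ List.replicate (n - k) (!x)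
  have hcount : ∀ x k, (f x k).count x = k + 1 := by
    intro x k
    simp [f, List.count_replicate]
  have hhead : ∀ x k, (f x k).head? = some x := by
    intro x k
    simp [f, List.replicate_succ]
  have heq : P00 (n + 1) ∪ P11 (n + 1) =
      (fun q : Bool × ℕ => f q.1 q.2) '' ((Finset.univ ×ˢ Finset.range n : Finset (Bool × ℕ))) := by
    ext w
    constructor
    · rintro (⟨k, h1, h2, rfl⟩ | ⟨k, h1, h2, rfl⟩)
      · refine ⟨(false, k - 1), by simp; omega, ?_⟩
        simp only [f, show k - 1 + 1 = k by omega, show n - (k - 1) = n + 1 - k by omega]; rfl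
      · refine ⟨(true, k - 1), by simp; omega, ?_⟩
        simp only [f, show k - 1 + 1 = k by omega, show n - (k - 1) = n + 1 - k by omega]; rfl
    · rintro ⟨⟨x, k⟩, hk, rfl⟩
      have hk : k < n := by simpa using hk
      cases x
      · exact Or.inl ⟨k + 1, by omega, by omega, by simp [f, zeros, ones]⟩
      · exact Or.inr ⟨k + 1, by omega, by omega, by simp [f, zeros, ones]⟩
  rw [heq, Set.ncard_image_of_injective, Set.ncard_coe_finset]
  · simp
  · rintro ⟨x, k⟩ ⟨y, l⟩ h
    simp only at h
    obtain rfl : x = y := by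
      have := hhead x k
      rw [h, hhead] at this
      exact (Option.some.inj this).symm
    have := hcount x k
    rw [h, hcount] at this
    simp only [Prod.mk.injEq, true_and]
    omega

lemma finite_bitonicWords (n : ℕ) : (bitonicWords n).Finite :=
  (List.finite_length_eq Bool n).subset fun _ hw => hw.1

lemma bitonicWords_one : bitonicWords 1 = {[false], [true]} := by
  ext w
  constructor
  · rintro ⟨hl, -⟩
    obtain ⟨a, rfl⟩ := List.length_eq_one_iff.1 hl
    cases a <;> simp
  · rintro (rfl | rfl) <;> exact ⟨rfl, by simp [IsBitonic]⟩

lemma bitonicWords_two :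
    bitonicWords 2 = {[false, false], [false, true], [true, false], [true, true]} := by
  ext w
  constructor
  · rintro ⟨hl, -⟩
    obtain ⟨a, b, rfl⟩ := List.length_eq_two.1 hl
    cases a <;> cases b <;> simp
  · rintro (rfl | rfl | rfl | rfl) <;> exact ⟨rfl, by simp [IsBitonic]⟩

lemma ncard_bitonicWords {n : ℕ} (hn : 1 ≤ n) : (bitonicWords n).ncard = n ^ 2 - n + 2 := by
  induction n, hn using Nat.le_induction with
  | base => rw [bitonicWords_one, Set.ncard_pair (by simp)]; norm_num
  | succ n hn ih =>
    have hfin := finite_bitonicWords (n + 1)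
    rw [bitonicWords_succ hn] at hfin ⊢
    have hnil : [] ∉ bitonicWords n := by
      rintro ⟨h, -⟩
      simp at h; omega
    rw [Set.ncard_union_eq (disjoint_appendFirst _ _) (hfin.subset Set.subset_union_left)
      (hfin.subset Set.subset_union_right), ncard_appendFirst hnil, ncard_P00_union_P11, ih]
    have h1 : n ≤ n ^ 2 := Nat.le_self_pow (by omega) n
    have h2 : (n + 1) ^ 2 = n ^ 2 + 2 * n + 1 := by ring
    omega

end BinWord

/-! ### Linear separation of points on the unit circle -/

/-- Twice the signed area of the triangle with vertices at angles `x`, `y`, `z` of the unit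
circle. -/
noncomputable def arcDet (x y z : ℝ) : ℝ :=
  Real.sin (y - x) + Real.sin (z - y) - Real.sin (z - x)

lemma arcDet_eq (x y z : ℝ) :
    arcDet x y z = 4 * Real.sin ((y - x) / 2) * Real.sin ((z - y) / 2) * Real.sin ((z - x) / 2) := by
  have h : ∀ a b : ℝ, Real.sin (2 * a) + Real.sin (2 * b) - Real.sin (2 * (a + b)) =
      4 * Real.sin a * Real.sin b * Real.sin (a + b) := by
    intro a b
    rw [Real.sin_two_mul, Real.sin_two_mul, Real.sin_two_mul, Real.sin_add, Real.cos_add]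
    have ha := Real.sin_sq_add_cos_sq a
    have hb := Real.sin_sq_add_cos_sq b
    linear_combination (-2 * Real.sin b * Real.cos b) * ha + (-2 * Real.sin a * Real.cos a) * hb
  have := h ((y - x) / 2) ((z - y) / 2)
  rw [show (y - x) / 2 + (z - y) / 2 = (z - x) / 2 by ring] at this
  rw [← this, arcDet]
  ring_nf

lemma arcDet_pos {x y z : ℝ} (hxy : x < y) (hyz : y < z) (hzx : z < x + 2 * Real.pi) :
    0 < arcDet x y z := by
  rw [arcDet_eq]
  have h : ∀ a : ℝ, 0 < a → a < 2 * Real.pi → 0 < Real.sin (a / 2) :=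
    fun a h0 h1 => Real.sin_pos_of_pos_of_lt_pi (by linarith) (by linarith)
  have h1 := h (y - x) (by linarith) (by linarith)
  have h2 := h (z - y) (by linarith) (by linarith)
  have h3 := h (z - x) (by linarith) (by linarith)
  positivity

/-- The affine dependency between four points of the unit circle. -/
lemma arcDet_relation (v : Plane) (c : ℝ) (i j k l : ℝ) :
    arcDet j k l * (⟪v, unitDir i⟫ - c) + arcDet i j l * (⟪v, unitDir k⟫ - c) =
      arcDet i k l * (⟪v, unitDir j⟫ - c) + arcDet i j k * (⟪v, unitDir l⟫ - c) := by
  simp only [inner_unitDir, arcDet, Real.sin_sub]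
  ring

/-- A line cannot strictly separate the endpoints of one diagonal of a quadrilateral inscribed in
the unit circle from the endpoints of the other. -/
lemma not_separate_diagonals (v : Plane) (c : ℝ) {i j k l : ℝ} (hij : i < j) (hjk : j < k)
    (hkl : k < l) (hli : l < i + 2 * Real.pi) (hi : c < ⟪v, unitDir i⟫) (hj : ⟪v, unitDir j⟫ < c)
    (hk : c < ⟪v, unitDir k⟫) (hl : ⟪v, unitDir l⟫ < c) : False := by
  have h := arcDet_relation v c i j k l
  have h1 := mul_pos (arcDet_pos hjk hkl (by linarith)) (sub_pos.2 hi)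
  have h2 := mul_pos (arcDet_pos hij (hjk.trans hkl) hli) (sub_pos.2 hk)
  have h3 := mul_pos (arcDet_pos (hij.trans hjk) hkl hli) (sub_pos.2 hj)
  have h4 := mul_pos (arcDet_pos hij hjk (by linarith)) (sub_pos.2 hl)
  linarith

/-- The chord with endpoints at angles `β` and `γ`, as a line `⟪v, ·⟫ = c`. -/
lemma inner_unitDir_midpoint (β γ θ : ℝ) :
    ⟪unitDir ((β + γ) / 2), unitDir θ⟫ - Real.cos ((γ - β) / 2) =
      2 * (Real.sin ((θ - β) / 2) * Real.sin ((γ - θ) / 2)) := by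
  have h1 : ⟪unitDir ((β + γ) / 2), unitDir θ⟫ = Real.cos ((θ - β) / 2 - (γ - θ) / 2) := by
    rw [inner_unitDir, show (θ - β) / 2 - (γ - θ) / 2 = θ - (β + γ) / 2 by ring, Real.cos_sub]
    simp [unitDir]
    ring
  have h2 : (γ - β) / 2 = (θ - β) / 2 + (γ - θ) / 2 := by ring
  rw [h1, h2, Real.cos_sub, Real.cos_add]
  ring

namespace Rosette

variable {n : ℕ} (R : Rosette n)

lemma isBitonic_of_cell_nonempty {σ : Fin n → Bool} (h : (R.cell σ).Nonempty) :
    BinWord.IsBitonic (List.ofFn σ) := by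
  by_contra hb
  obtain ⟨i, j, k, l, hij, hjk, hkl, hj, hk, hl⟩ :=
    BinWord.exists_alternating_of_not_isBitonic σ hb
  obtain ⟨x, hx⟩ := h
  rw [mem_cell_iff] at hx
  have aij := R.angle_strictMono hij
  have ajk := R.angle_strictMono hjk
  have akl := R.angle_strictMono hkl
  have ali := R.angle_lt i l
  cases hi : σ i with
  | true =>
    rw [hi] at hj hk hl
    exact not_separate_diagonals _ _ aij ajk akl ali ((hx i).1 hi) ((hx j).2 hj) ((hx k).1 hk)
      ((hx l).2 hl)
  | false =>
    rw [hi] at hj hk hl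
    -- replacing the line by its negative exchanges its two sides
    refine not_separate_diagonals (-(x - R.O)) (-((‖x - R.O‖ ^ 2 + 1 - R.r ^ 2) / 2))
      aij ajk akl ali ?_ ?_ ?_ ?_ <;> rw [inner_neg_left, neg_lt_neg_iff]
    exacts [(hx i).2 hi, (hx j).1 hj, (hx k).2 hk, (hx l).1 hl]

/-- A chord that cuts the unit circle between consecutive centres separates the centres of index in
`[k, k + m)` from the others. -/
lemma exists_separating_chord {k m : ℕ} (hk : 0 < k) (hm : 0 < m) (hkm : k + m ≤ n) :
    ∃ v : Plane, v ≠ 0 ∧ ∃ c : ℝ, ∀ i : Fin n,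
      (k ≤ i ∧ (i : ℕ) < k + m → c < ⟪v, unitDir (R.angle i)⟫) ∧
      (¬ (k ≤ i ∧ (i : ℕ) < k + m) → ⟪v, unitDir (R.angle i)⟫ < c) := by
  have hn : 0 < n := by omega
  -- the first centre, one full turn later, comes after the last one
  let A : ℕ → ℝ := fun j => if h : j < n then R.angle ⟨j, h⟩ else R.angle ⟨0, hn⟩ + 2 * Real.pi
  have hAi : ∀ i : Fin n, A i = R.angle i := fun i => by simp [A]
  have hAmono : ∀ a b, a < b → b ≤ n → A a < A b := by
    intro a b hab hb
    have ha : a < n := by omega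
    by_cases hbn : b < n
    · simp only [A, ha, hbn, dif_pos]
      exact R.angle_strictMono hab
    · simp only [A, ha, hbn, dif_pos, dif_neg, not_false_eq_true]
      exact R.angle_lt _ _
  have hAle : ∀ a b, a ≤ b → b ≤ n → A a ≤ A b := by
    intro a b hab hb
    rcases hab.eq_or_lt with rfl | h
    · exact le_rfl
    · exact (hAmono a b h hb).le
  have hAn : A n = A 0 + 2 * Real.pi := by simp [A, hn]
  set β := (A (k - 1) + A k) / 2 with hβ
  set γ := (A (k + m - 1) + A (k + m)) / 2 with hγ
  have b1 := hAmono (k - 1) k (by omega) (by omega)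
  have g1 := hAmono (k + m - 1) (k + m) (by omega) (by omega)
  have gn := hAle (k + m) n hkm le_rfl
  have b0 := hAle 0 (k - 1) (by omega) (by omega)
  have hsin : ∀ a : ℝ, 0 < a → a < 2 * Real.pi → 0 < Real.sin (a / 2) :=
    fun a h0 h1 => Real.sin_pos_of_pos_of_lt_pi (by linarith) (by linarith)
  have hsin' : ∀ a : ℝ, a < 0 → -(2 * Real.pi) < a → Real.sin (a / 2) < 0 :=
    fun a h0 h1 => Real.sin_neg_of_neg_of_neg_pi_lt (by linarith) (by linarith)
  refine ⟨unitDir ((β + γ) / 2), ?_, Real.cos ((γ - β) / 2), fun i => ?_⟩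
  · rw [← norm_ne_zero_iff, norm_unitDir]
    exact one_ne_zero
  have key := inner_unitDir_midpoint β γ (R.angle i)
  rw [← hAi] at key ⊢
  have i0 := hAle 0 i (by omega) (by omega)
  have iN := hAmono i n i.2 le_rfl
  constructor
  · rintro ⟨h1, h2⟩
    have e1 := hAle k i h1 (by omega)
    have e2 := hAle i (k + m - 1) (by omega) (by omega)
    have s1 := hsin (A i - β) (by linarith) (by linarith)
    have s2 := hsin (γ - A i) (by linarith) (by linarith)
    have := mul_pos s1 s2
    linarith
  · intro h
    rcases lt_or_ge (i : ℕ) k with h1 | h1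
    · have e1 := hAle i (k - 1) (by omega) (by omega)
      have e2 := hAle k (k + m - 1) (by omega) (by omega)
      have s1 := hsin' (A i - β) (by linarith) (by linarith)
      have s2 := hsin (γ - A i) (by linarith) (by linarith)
      have := mul_neg_of_neg_of_pos s1 s2
      linarith
    · have e1 := hAle (k + m) i (by omega) (by omega)
      have e2 := hAle k (k + m - 1) (by omega) (by omega)
      have s1 := hsin (A i - β) (by linarith) (by linarith)
      have s2 := hsin' (γ - A i) (by linarith) (by linarith)
      have := mul_neg_of_pos_of_neg s1 s2
      linarith

lemma cell_true_nonempty : (R.cell fun _ => true).Nonempty := by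
  refine ⟨R.O, fun i => ⟨fun _ => ?_, fun h => by simp at h⟩⟩
  rw [Metric.mem_ball, center_eq, dist_self_add_right, norm_unitDir]
  exact R.one_lt_r

lemma cell_false_nonempty : (R.cell fun _ => false).Nonempty := by
  refine ⟨R.O + (R.r + 2) • unitDir 0, R.mem_cell_false_of_le ?_⟩
  rw [add_sub_cancel_left, norm_smul, norm_unitDir, mul_one]
  exact le_abs_self _

lemma cell_nonempty_of_eq_threeBlocks {σ : Fin n → Bool} {x : Bool} {k m p : ℕ}
    (h : List.ofFn σ = BinWord.threeBlocks x (k + 1) m p) : (R.cell σ).Nonempty := by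
  have hlen : n = k + 1 + (m + p) := by
    rw [← BinWord.length_threeBlocks x, ← h, List.length_ofFn]
  have hσ : ∀ i : Fin n, σ i = if k + 1 ≤ i ∧ (i : ℕ) < k + 1 + m then !x else x := by
    intro i
    have h1 : (List.ofFn σ)[(i : ℕ)]? = some (σ i) := by simp
    rw [h, BinWord.threeBlocks, List.getElem?_append, List.getElem?_append] at h1
    simp only [List.length_replicate, List.getElem?_replicate] at h1
    have hi := i.2
    split_ifs at h1 ⊢ <;> first | omega | exact (Option.some.inj h1).symm
  rcases m.eq_zero_or_pos with rfl | hm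
  · have : σ = fun _ => x := by
      ext i
      rw [hσ, if_neg (by omega)]
    rw [this]
    cases x
    · exact R.cell_false_nonempty
    · exact R.cell_true_nonempty
  · obtain ⟨v, hv, c, hc⟩ := R.exists_separating_chord (k := k + 1) (m := m) (by omega) hm
      (by omega)
    cases x with
    | false =>
      refine ⟨_, R.coneProj_mem_cell (p := (v, c)) (fun i => ?_) hv⟩
      have := hc i
      rw [hσ]
      split_ifs with hi
      · exact ⟨fun _ => this.1 hi, by simp⟩
      · exact ⟨by simp, fun _ => this.2 hi⟩
    | true =>
      refine ⟨_, R.coneProj_mem_cell (p := (-v, -c)) (fun i => ?_) (neg_ne_zero.2 hv)⟩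
      have := hc i
      simp only [inner_neg_left, neg_lt_neg_iff]
      rw [hσ]
      split_ifs with hi
      · exact ⟨by simp, fun _ => this.1 hi⟩
      · exact ⟨fun _ => this.2 hi, by simp⟩

lemma words_eq_bitonicWords (hn : 1 ≤ n) : R.words = BinWord.bitonicWords n := by
  ext w
  rw [mem_words_iff]
  constructor
  · rintro ⟨σ, rfl, hσ⟩
    exact ⟨List.length_ofFn, R.isBitonic_of_cell_nonempty hσ⟩
  · intro hw
    obtain ⟨σ, rfl⟩ : ∃ σ : Fin n → Bool, w = List.ofFn σ := by
      obtain ⟨rfl, -⟩ := hw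
      exact ⟨w.get, (List.ofFn_get w).symm⟩
    obtain ⟨x, k, m, p, -, h⟩ := (BinWord.mem_bitonicWords_iff hn _).1 hw
    exact ⟨σ, rfl, R.cell_nonempty_of_eq_threeBlocks h⟩

end Rosette

theorem mainTheorem7 :
    -- regions and words determine each other
    (∀ (n : ℕ) (R : Rosette n),
      (∀ U ∈ R.regions, ∃! w, R.Encodes w U) ∧
      (∀ w ∈ R.words, ∃! U, U ∈ R.regions ∧ R.Encodes w U)) ∧
    -- the recursive construction
    (∀ (n : ℕ), 1 ≤ n → ∀ (R : Rosette n) (R' : Rosette (n + 1)),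
      R'.words =
        BinWord.appendFirst R.words ∪ (BinWord.P00 (n + 1) ∪ BinWord.P11 (n + 1)) ∧
      Disjoint (BinWord.appendFirst R.words) (BinWord.P00 (n + 1) ∪ BinWord.P11 (n + 1))) ∧
    -- the explicit description
    (∀ R : Rosette 1, R.words = {[false], [true]}) ∧
    (∀ R : Rosette 2,
      R.words = {[false, false], [false, true], [true, false], [true, true]}) ∧
    (∀ (n : ℕ), 1 ≤ n → ∀ R : Rosette n,
      R.words = {BinWord.zeros n, BinWord.ones n} ∪ BinWord.P00 n ∪ BinWord.P11 n ∪
        BinWord.P01 n ∪ BinWord.P10 n ∧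
      R.words = {w | w.length = n ∧ BinWord.IsBitonic w} ∧
      R.words.ncard = n ^ 2 - n + 2) := by
  refine ⟨fun n R => ⟨fun U => R.existsUnique_encodes, fun w => R.existsUnique_region⟩,
    fun n hn R R' => ⟨?_, BinWord.disjoint_appendFirst _ _⟩, fun R => ?_, fun R => ?_,
    fun n hn R => ⟨?_, R.words_eq_bitonicWords hn, ?_⟩⟩
  · rw [R.words_eq_bitonicWords hn, R'.words_eq_bitonicWords (by omega),
      BinWord.bitonicWords_succ hn]
  · rw [R.words_eq_bitonicWords le_rfl, BinWord.bitonicWords_one]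
  · rw [R.words_eq_bitonicWords one_le_two, BinWord.bitonicWords_two]
  · rw [R.words_eq_bitonicWords hn, BinWord.bitonicWords_eq hn]
  · rw [R.words_eq_bitonicWords hn, BinWord.ncard_bitonicWords hn]
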